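/- For $n\ge 0$ let $$L_n(t)=\frac{1}{n!}\,e^{t}\left(\frac{d}{dt}\right)^{n}\left(e^{-t}t^{n}\right)$$ be the $n$-th classical Laguerre polynomial. Then for every integer $n\ge 1$, $$\left|L_n(1)-\sqrt{\frac{e}{\pi}}\cdot\frac{\cos\left(2\sqrt{n}-\frac{\pi}{4}\right)}{n^{1/4}}\right|<\frac{2.38}{n^{3/4}}.$$ -/

import Mathlib

/-- The `n`-th classical Laguerre polynomial as a function on `ℝ`, given by the Rodrigues formula
`L_n(t) = (1 / n!) * e^t * (d/dt)^n (e^(-t) * t^n)`. -/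
noncomputable def laguerreL (n : ℕ) (t : ℝ) : ℝ :=
  1 / (n.factorial : ℝ) * Real.exp t * iteratedDeriv n (fun x : ℝ => Real.exp (-x) * x ^ n) t

/-!
The proof compares `L_n` with the Bessel function `J₀`.

Put `κ = 2√n` and `v(s) = e^(-s²/2) L_n(s²)`, so that `L_n(1) = √e v(1)`. Laguerre's equation turns
into `v'' + v'/s + κ² v = (s² - 2) v`, which is the equation of `J₀(κs)` up to the right-hand side,
and both functions equal `1` at `s = 0`. For the difference `D`, an energy argument applied to
`√s D` gives `κ √s |D(s)| ≤ ∫₀ˢ (2 - σ²) √σ |v(σ)| dσ`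
(`mul_sqrt_mul_abs_le_of_bessel_ode`). Inserting the maximum `m` of `√s |v|` over `[0, 1]` on the
right, and `√x |J₀(x)| ≤ 1.1`, bounds `√κ m` first and then `κ^(3/2) |D(1)|`
(`pow_three_mul_abs_laguerreL_sub_besselJZero_le`).

It remains to replace `J₀(κ)` by its leading term `(cos κ + sin κ) / √(πκ) = √(2/(πκ)) cos(κ - π/4)`
with an error `O(κ^(-3/2))`; this is `abs_sqrt_mul_besselJZero_sub_le`. There the path of
integration in `J₀(x) = (2/π) Re ∫₀¹ e^(ixu) (1 - u²)^(-1/2) du` is moved to the two vertical lines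
above `0` and `1`. The line above `0` contributes a purely imaginary number, and on the line above
`1` the integrand decays exponentially and is governed by its singularity at `u = 1`.

The resulting constants are good enough for `n ≥ 3`. For `n = 1, 2` the values `L_1(1) = 0` and
`L_2(1) = -1/2` and the bound `|cos| ≤ 1` are sufficient.
-/

open Set Filter Topology MeasureTheory

/-! ### Laguerre's differential equation -/

lemma contDiff_exp_neg_mul_pow (n : ℕ) :
    ContDiff ℝ (⊤ : ℕ∞) (fun x : ℝ => Real.exp (-x) * x ^ n) := by
  fun_prop

lemma hasDerivAt_iteratedDeriv_exp_neg_mul_pow (n k : ℕ) (t : ℝ) :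
    HasDerivAt (iteratedDeriv k (fun x : ℝ => Real.exp (-x) * x ^ n))
      (iteratedDeriv (k + 1) (fun x : ℝ => Real.exp (-x) * x ^ n) t) t := by
  rw [iteratedDeriv_succ]
  exact ((contDiff_exp_neg_mul_pow n).differentiable_iteratedDeriv k
    (by exact_mod_cast WithTop.coe_lt_top _) t).hasDerivAt

/-- Every derivative of `y = e⁻ᵗ tⁿ` satisfies a second order equation, obtained by differentiating
`t y' = (n - t) y` repeatedly. -/
lemma iteratedDeriv_exp_neg_mul_pow_ode (n k : ℕ) (t : ℝ) :
    t * iteratedDeriv (k + 2) (fun x : ℝ => Real.exp (-x) * x ^ n) t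
      + (k + 1 + t - n) * iteratedDeriv (k + 1) (fun x : ℝ => Real.exp (-x) * x ^ n) t
      + (k + 1) * iteratedDeriv k (fun x : ℝ => Real.exp (-x) * x ^ n) t = 0 := by
  set Y : ℕ → ℝ → ℝ := fun k => iteratedDeriv k (fun x : ℝ => Real.exp (-x) * x ^ n) with hY
  have hd : ∀ k t, HasDerivAt (Y k) (Y (k + 1) t) t :=
    hasDerivAt_iteratedDeriv_exp_neg_mul_pow n
  change t * Y (k + 2) t + (k + 1 + t - n) * Y (k + 1) t + (k + 1) * Y k t = 0
  induction k generalizing t with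
  | zero =>
    have h0 : ∀ t, t * Y 1 t + (t - n) * Y 0 t = 0 := by
      intro t
      have h1 : HasDerivAt (Y 0) (-Real.exp (-t) * t ^ n + Real.exp (-t) * (n * t ^ (n - 1))) t := by
        simp only [hY, iteratedDeriv_zero]
        have := ((hasDerivAt_neg t).exp).mul (hasDerivAt_pow n t)
        refine this.congr_deriv ?_
        ring
      rw [(hd 0 t).unique h1]
      simp only [hY, iteratedDeriv_zero]
      rcases n with _ | n
      · simp
      · simp only [Nat.add_sub_cancel, pow_succ]
        ring
    have h2 : HasDerivAt (fun t => t * Y 1 t + (t - n) * Y 0 t)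
        (1 * Y 1 t + t * Y 2 t + (1 * Y 0 t + (t - n) * Y 1 t)) t :=
      ((hasDerivAt_id t).mul (hd 1 t)).add (((hasDerivAt_id t).sub_const (n : ℝ)).mul (hd 0 t))
    have h3 := h2.unique ((hasDerivAt_const t (0 : ℝ)).congr_of_eventuallyEq
      (Filter.Eventually.of_forall h0))
    simp only [Nat.cast_zero]
    linear_combination h3
  | succ k ih =>
    have h2 : HasDerivAt (fun t => t * Y (k + 2) t + (k + 1 + t - n) * Y (k + 1) t
          + (k + 1) * Y k t)
        (1 * Y (k + 2) t + t * Y (k + 3) t + (1 * Y (k + 1) t + (k + 1 + t - n) * Y (k + 2) t)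
          + (k + 1) * Y (k + 1) t) t :=
      (((hasDerivAt_id t).mul (hd (k + 2) t)).add
        ((((hasDerivAt_id t).const_add ((k : ℝ) + 1)).sub_const (n : ℝ)).mul (hd (k + 1) t))).add
        ((hd k t).const_mul _)
    have h3 := h2.unique ((hasDerivAt_const t (0 : ℝ)).congr_of_eventuallyEq
      (Filter.Eventually.of_forall ih))
    push_cast
    linear_combination h3

lemma iteratedDeriv_exp_neg_mul_pow_zero (n : ℕ) :
    iteratedDeriv n (fun x : ℝ => Real.exp (-x) * x ^ n) 0 = n.factorial := by
  rw [iteratedDeriv_fun_mul (by fun_prop) (by fun_prop), Finset.sum_eq_single 0]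
  · simp [iteratedDeriv_eq_iterate, Nat.descFactorial_self]
  · intro i _ hi
    rcases Nat.lt_or_ge n i with h | h
    · simp [Nat.choose_eq_zero_of_lt h]
    · have : n - (n - i) ≠ 0 := by omega
      simp [iteratedDeriv_eq_iterate, this]
  · simp

lemma laguerreL_zero_right (n : ℕ) : laguerreL n 0 = 1 := by
  rw [laguerreL, iteratedDeriv_exp_neg_mul_pow_zero]
  simp [Nat.factorial_ne_zero]

/-- Laguerre's differential equation `t L'' + (1 - t) L' + n L = 0`. -/
lemma exists_laguerreL_deriv_ode (n : ℕ) : ∃ L' L'' : ℝ → ℝ,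
    (∀ t, HasDerivAt (laguerreL n) (L' t) t) ∧ (∀ t, HasDerivAt L' (L'' t) t) ∧
      ∀ t, t * L'' t + (1 - t) * L' t + n * laguerreL n t = 0 := by
  set Y : ℕ → ℝ → ℝ := fun k => iteratedDeriv k (fun x : ℝ => Real.exp (-x) * x ^ n) with hY
  have hd : ∀ k t, HasDerivAt (Y k) (Y (k + 1) t) t :=
    hasDerivAt_iteratedDeriv_exp_neg_mul_pow n
  have hL : laguerreL n = fun t => 1 / (n.factorial : ℝ) * Real.exp t * Y n t := rfl
  refine ⟨fun t => 1 / (n.factorial : ℝ) * Real.exp t * (Y n t + Y (n + 1) t),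
    fun t => 1 / (n.factorial : ℝ) * Real.exp t * (Y n t + 2 * Y (n + 1) t + Y (n + 2) t),
    fun t => ?_, fun t => ?_, fun t => ?_⟩
  · rw [hL]
    refine (((Real.hasDerivAt_exp t).const_mul _).mul (hd n t)).congr_deriv ?_
    ring
  · refine (((Real.hasDerivAt_exp t).const_mul _).mul
      ((hd n t).add (hd (n + 1) t))).congr_deriv ?_
    simp only [Pi.add_apply]
    ring
  · have h := iteratedDeriv_exp_neg_mul_pow_ode n n t
    change t * Y (n + 2) t + (n + 1 + t - n) * Y (n + 1) t + (n + 1) * Y n t = 0 at h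
    simp only [hL]
    linear_combination 1 / (n.factorial : ℝ) * Real.exp t * h

/-- The function `v(s) = e^(-s²/2) L_n(s²)` solves a perturbed Bessel equation of order zero. -/
lemma exists_laguerreL_sq_deriv_ode (n : ℕ) : ∃ v' v'' : ℝ → ℝ,
    (∀ s, HasDerivAt (fun s => Real.exp (-s ^ 2 / 2) * laguerreL n (s ^ 2)) (v' s) s) ∧
    (∀ s, HasDerivAt v' (v'' s) s) ∧
    ∀ s, s * v'' s + v' s
      + (4 * n + 2 - s ^ 2) * s * (Real.exp (-s ^ 2 / 2) * laguerreL n (s ^ 2)) = 0 := by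
  obtain ⟨L', L'', h1, h2, hode⟩ := exists_laguerreL_deriv_ode n
  have hsq : ∀ s : ℝ, HasDerivAt (fun s : ℝ => s ^ 2) (2 * s) s := fun s => by
    simpa using hasDerivAt_pow 2 s
  have hexp : ∀ s : ℝ, HasDerivAt (fun s : ℝ => Real.exp (-s ^ 2 / 2))
      (-s * Real.exp (-s ^ 2 / 2)) s := fun s => by
    refine (((hsq s).neg.div_const 2).exp).congr_deriv ?_
    simp only [Pi.neg_apply]
    ring
  have hc1 : ∀ s : ℝ, HasDerivAt (fun s => laguerreL n (s ^ 2)) (L' (s ^ 2) * (2 * s)) s :=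
    fun s => HasDerivAt.comp (h₂ := laguerreL n) s (h1 (s ^ 2)) (hsq s)
  have hc2 : ∀ s : ℝ, HasDerivAt (fun s => L' (s ^ 2)) (L'' (s ^ 2) * (2 * s)) s :=
    fun s => HasDerivAt.comp (h₂ := L') s (h2 (s ^ 2)) (hsq s)
  refine ⟨fun s => Real.exp (-s ^ 2 / 2) * (s * (2 * L' (s ^ 2) - laguerreL n (s ^ 2))),
    fun s => Real.exp (-s ^ 2 / 2) * ((s ^ 2 - 1) * laguerreL n (s ^ 2)
      + (2 - 4 * s ^ 2) * L' (s ^ 2) + 4 * s ^ 2 * L'' (s ^ 2)), fun s => ?_, fun s => ?_,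
    fun s => ?_⟩
  · refine ((hexp s).mul (hc1 s)).congr_deriv ?_
    ring
  · refine ((hexp s).mul ((hasDerivAt_id s).mul
      (((hc2 s).const_mul 2).sub (hc1 s)))).congr_deriv ?_
    simp only [Pi.mul_apply, Pi.sub_apply, id]
    ring
  · linear_combination 4 * s * Real.exp (-s ^ 2 / 2) * hode (s ^ 2)

lemma laguerreL_one_one : laguerreL 1 1 = 0 := by
  have h : deriv (fun x : ℝ => Real.exp (-x) * x ^ 1) 1 = 0 := by
    have := ((hasDerivAt_neg (1 : ℝ)).exp).mul (hasDerivAt_pow 1 1)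
    refine (this.congr_deriv ?_).deriv
    simp
  rw [laguerreL, iteratedDeriv_one, h, mul_zero]

lemma laguerreL_two_one : laguerreL 2 1 = -1 / 2 := by
  have h : deriv (fun x : ℝ => Real.exp (-x) * x ^ 2)
      = fun x => Real.exp (-x) * (2 * x - x ^ 2) := by
    funext x
    have := ((hasDerivAt_neg x).exp).mul (hasDerivAt_pow 2 x)
    refine (this.congr_deriv ?_).deriv
    simp
    ring
  have h' : deriv (fun x : ℝ => Real.exp (-x) * (2 * x - x ^ 2)) 1 = -Real.exp (-1) := by
    have := ((hasDerivAt_neg (1 : ℝ)).exp).mul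
      (((hasDerivAt_id (1 : ℝ)).const_mul 2).sub (hasDerivAt_pow 2 1))
    refine (this.congr_deriv ?_).deriv
    simp
    ring
  rw [laguerreL, iteratedDeriv_succ, iteratedDeriv_one, h, h']
  have : Real.exp 1 * Real.exp (-1) = 1 := by rw [← Real.exp_add]; simp
  simp only [Nat.factorial_two, Nat.cast_ofNat]
  linear_combination -(1 / 2) * this

/-! ### An energy estimate for Bessel's equation -/

/-- Energy estimate for the inhomogeneous Bessel equation of order zero. With `w = √s D` the energy
`E = w'² + (κ² + 1/(4s²)) w²` satisfies `E' ≤ 2 √s F w'`, so that `√E` grows at most at rate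
`√s |F|`. -/
lemma mul_sqrt_mul_abs_le_of_bessel_ode {D D' D'' F p P : ℝ → ℝ} {κ : ℝ} (hκ : 0 < κ)
    (hD : ∀ s, HasDerivAt D (D' s) s) (hD' : ∀ s, HasDerivAt D' (D'' s) s)
    (hode : ∀ s, 0 < s → s * D'' s + D' s + κ ^ 2 * s * D s = s * F s) (hD0 : D 0 = 0)
    (hP : ∀ s, HasDerivAt P (p s) s) (hP0 : P 0 = 0)
    (hF : ∀ s ∈ Ioo (0 : ℝ) 1, √s * |F s| ≤ p s) {s : ℝ} (hs : s ∈ Icc (0 : ℝ) 1) :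
    κ * (√s * |D s|) ≤ P s := by
  set E : ℝ → ℝ := fun s => s * D' s ^ 2 + D s * D' s + D s ^ 2 / (2 * s) + κ ^ 2 * s * D s ^ 2
    with hE
  have hE_lower : ∀ s, 0 < s →
      E s = (s * D' s + D s / 2) ^ 2 / s + D s ^ 2 / (4 * s) + κ ^ 2 * s * D s ^ 2 := by
    intro s hs
    simp only [hE]
    field_simp
    ring
  have hE_nonneg : ∀ s, 0 ≤ s → 0 ≤ E s := by
    intro s hs
    rcases hs.eq_or_lt with rfl | hs
    · simp [hE, hD0]
    · rw [hE_lower s hs]; positivity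
  have hDc : Continuous D := continuous_iff_continuousAt.2 fun s => (hD s).continuousAt
  have hD'c : Continuous D' := continuous_iff_continuousAt.2 fun s => (hD' s).continuousAt
  have hEderiv : ∀ s, 0 < s →
      HasDerivAt E (2 * F s * (s * D' s + D s / 2) - D s ^ 2 / (2 * s ^ 2)) s := by
    intro s hs
    have h1 := (((hasDerivAt_id s).mul ((hD' s).pow 2)).add ((hD s).mul (hD' s))).add
      (((hD s).pow 2).div ((hasDerivAt_id s).const_mul 2) (by simpa using hs.ne'))
    have h2 := h1.add (((hasDerivAt_id s).const_mul (κ ^ 2)).mul ((hD s).pow 2))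
    refine h2.congr_deriv ?_
    have hF : F s = D'' s + D' s / s + κ ^ 2 * D s := by
      have := hode s hs
      field_simp
      linear_combination -this
    simp only [hF, id, Pi.pow_apply]
    field_simp
    ring
  have hEc : ContinuousOn E (Icc 0 1) := by
    intro s hs
    rcases hs.1.eq_or_lt with rfl | h
    · have hEq : E = fun s => s * D' s ^ 2 + D s * D' s + D s * dslope D 0 s / 2
          + κ ^ 2 * s * D s ^ 2 := by
        funext s
        rcases eq_or_ne s 0 with rfl | h
        · simp [hE, hD0]
        · rw [dslope_of_ne _ h, slope_def_field, hD0]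
          simp only [hE]
          field_simp
          ring
      have hdc : ContinuousAt (dslope D 0) 0 := continuousAt_dslope_same.2 (hD 0).differentiableAt
      rw [hEq]
      refine ContinuousAt.continuousWithinAt ?_
      fun_prop
    · exact (hEderiv s h).continuousAt.continuousWithinAt
  -- The square root of the energy need not be differentiable where the energy vanishes.
  have key : ∀ δ > 0, √(E s + δ ^ 2) - P s ≤ δ := by
    intro δ hδ
    have hpos : ∀ s, 0 ≤ s → 0 < E s + δ ^ 2 := fun s hs => by
      have := hE_nonneg s hs
      positivity
    have hderiv : ∀ s, 0 < s → HasDerivAt (fun s => √(E s + δ ^ 2) - P s)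
        ((2 * F s * (s * D' s + D s / 2) - D s ^ 2 / (2 * s ^ 2)) / (2 * √(E s + δ ^ 2)) - p s) s :=
      fun s hs => (((hEderiv s hs).add_const _).sqrt (hpos s hs.le).ne').sub (hP s)
    have hanti : AntitoneOn (fun s => √(E s + δ ^ 2) - P s) (Icc 0 1) := by
      refine antitoneOn_of_deriv_nonpos (convex_Icc 0 1) ?_ ?_ ?_
      · refine (Real.continuous_sqrt.comp_continuousOn (hEc.add continuousOn_const)).sub ?_
        exact fun s _ => (hP s).continuousAt.continuousWithinAt
      · rw [interior_Icc]
        exact fun s hs => (hderiv s hs.1).differentiableAt.differentiableWithinAt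
      · rw [interior_Icc]
        intro s hs
        rw [(hderiv s hs.1).deriv, sub_nonpos, div_le_iff₀ (by have := hpos s hs.1.le; positivity)]
        have hs0 := hs.1
        have hsq : 0 < √s := Real.sqrt_pos.2 hs0
        have hw : |s * D' s + D s / 2| ≤ √s * √(E s + δ ^ 2) := by
          rw [← Real.sqrt_mul hs0.le]
          refine Real.abs_le_sqrt ?_
          have h1 : (s * D' s + D s / 2) ^ 2 / s ≤ E s + δ ^ 2 := by
            rw [hE_lower s hs0]
            have : 0 ≤ D s ^ 2 / (4 * s) + κ ^ 2 * s * D s ^ 2 + δ ^ 2 := by positivity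
            linarith
          rw [div_le_iff₀ hs0] at h1
          linarith
        have h2 : F s * (s * D' s + D s / 2) ≤ p s * √(E s + δ ^ 2) := by
          calc F s * (s * D' s + D s / 2) ≤ |F s| * |s * D' s + D s / 2| := by
                rw [← abs_mul]; exact le_abs_self _
            _ ≤ |F s| * (√s * √(E s + δ ^ 2)) := by gcongr
            _ = √s * |F s| * √(E s + δ ^ 2) := by ring
            _ ≤ p s * √(E s + δ ^ 2) := by gcongr; exact hF s hs
        have h3 : 0 ≤ D s ^ 2 / (2 * s ^ 2) := by positivity
        linarith
    have := hanti (left_mem_Icc.2 zero_le_one) hs hs.1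
    have hE0 : E 0 = 0 := by simp [hE, hD0]
    simpa [hE0, hP0, Real.sqrt_sq hδ.le] using this
  have hle : κ * (√s * |D s|) ≤ √(E s) := by
    rcases hs.1.eq_or_lt with rfl | h
    · simp
    · refine Real.le_sqrt_of_sq_le ?_
      rw [hE_lower s h, mul_pow, mul_pow, Real.sq_sqrt hs.1, sq_abs]
      have : 0 ≤ (s * D' s + D s / 2) ^ 2 / s + D s ^ 2 / (4 * s) := by positivity
      linarith
  refine le_of_forall_pos_le_add fun δ hδ => ?_
  have h1 : √(E s) ≤ √(E s + δ ^ 2) := Real.sqrt_le_sqrt (by linarith [sq_nonneg δ])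
  linarith [key δ hδ]

/-! ### The Bessel function of order zero -/

/-- The Bessel function of the first kind of order zero, by its Poisson integral
`(2/π) ∫_0^(π/2) cos (x sin θ) dθ`. -/
noncomputable def besselJZero (x : ℝ) : ℝ :=
  2 / Real.pi * ∫ θ in (0 : ℝ)..Real.pi / 2, Real.cos (x * Real.sin θ)

lemma abs_besselJZero_le_one (x : ℝ) : |besselJZero x| ≤ 1 := by
  have h : ‖∫ θ in (0 : ℝ)..Real.pi / 2, Real.cos (x * Real.sin θ)‖ ≤ 1 * |Real.pi / 2 - 0| :=
    intervalIntegral.norm_integral_le_of_norm_le_const fun θ _ => Real.abs_cos_le_one _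
  have hpi := Real.pi_pos
  rw [Real.norm_eq_abs, sub_zero, abs_of_pos (a := Real.pi / 2) (by positivity), one_mul] at h
  rw [besselJZero, abs_mul, abs_of_pos (a := 2 / Real.pi) (by positivity)]
  calc 2 / Real.pi * |∫ θ in (0 : ℝ)..Real.pi / 2, Real.cos (x * Real.sin θ)|
      ≤ 2 / Real.pi * (Real.pi / 2) := by gcongr
    _ = 1 := by field_simp

lemma besselJZero_zero : besselJZero 0 = 1 := by
  have hpi := Real.pi_ne_zero
  simp [besselJZero]

lemma hasDerivAt_intervalIntegral_of_continuous_of_bound {G G' : ℝ → ℝ → ℝ} {a b C : ℝ}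
    (hG : ∀ x, Continuous (G x)) (hG' : ∀ x, Continuous (G' x))
    (hd : ∀ x θ, HasDerivAt (fun x => G x θ) (G' x θ) x) (hb : ∀ x θ, |G' x θ| ≤ C) (x : ℝ) :
    HasDerivAt (fun x => ∫ θ in a..b, G x θ) (∫ θ in a..b, G' x θ) x :=
  (intervalIntegral.hasDerivAt_integral_of_dominated_loc_of_deriv_le (bound := fun _ => C)
    univ_mem (Eventually.of_forall fun x => (hG x).aestronglyMeasurable)
    ((hG x).intervalIntegrable _ _) (hG' x).aestronglyMeasurable
    (Eventually.of_forall fun θ _ x _ => hb x θ) intervalIntegrable_const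
    (Eventually.of_forall fun θ _ x _ => hd x θ)).2

/-- Bessel's equation `x J'' + J' + x J = 0`. -/
lemma exists_besselJZero_deriv_ode : ∃ J' J'' : ℝ → ℝ,
    (∀ x, HasDerivAt besselJZero (J' x) x) ∧ (∀ x, HasDerivAt J' (J'' x) x) ∧
      ∀ x, x * J'' x + J' x + x * besselJZero x = 0 := by
  refine ⟨fun x => 2 / Real.pi * ∫ θ in (0 : ℝ)..Real.pi / 2,
      -(Real.sin θ * Real.sin (x * Real.sin θ)),
    fun x => 2 / Real.pi * ∫ θ in (0 : ℝ)..Real.pi / 2,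
      -(Real.sin θ ^ 2 * Real.cos (x * Real.sin θ)), fun x => ?_, fun x => ?_, fun x => ?_⟩
  · refine (hasDerivAt_intervalIntegral_of_continuous_of_bound (C := 1)
      (G := fun x θ => Real.cos (x * Real.sin θ))
      (G' := fun x θ => -(Real.sin θ * Real.sin (x * Real.sin θ))) (fun x => by fun_prop)
      (fun x => by fun_prop) (fun x θ => ?_) (fun x θ => ?_) x).const_mul _
    · refine (((hasDerivAt_id x).mul_const (Real.sin θ)).cos).congr_deriv ?_
      simp
      ring
    · rw [abs_neg, abs_mul]
      exact mul_le_one₀ (Real.abs_sin_le_one _) (abs_nonneg _) (Real.abs_sin_le_one _)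
  · refine (hasDerivAt_intervalIntegral_of_continuous_of_bound (C := 1)
      (G := fun x θ => -(Real.sin θ * Real.sin (x * Real.sin θ)))
      (G' := fun x θ => -(Real.sin θ ^ 2 * Real.cos (x * Real.sin θ))) (fun x => by fun_prop)
      (fun x => by fun_prop) (fun x θ => ?_) (fun x θ => ?_) x).const_mul _
    · refine ((((hasDerivAt_id x).mul_const (Real.sin θ)).sin.const_mul _).neg).congr_deriv ?_
      simp
      ring
    · rw [abs_neg, abs_mul, abs_pow]
      exact mul_le_one₀ (pow_le_one₀ (abs_nonneg _) (Real.abs_sin_le_one _)) (abs_nonneg _)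
        (Real.abs_cos_le_one _)
  · -- All three integrands combine into the derivative of `cos θ sin (x sin θ)`.
    have hd : ∀ θ ∈ uIcc 0 (Real.pi / 2),
        HasDerivAt (fun θ => Real.cos θ * Real.sin (x * Real.sin θ))
          (-(Real.sin θ * Real.sin (x * Real.sin θ))
            + x * (Real.cos (x * Real.sin θ) + -(Real.sin θ ^ 2 * Real.cos (x * Real.sin θ)))) θ := by
      intro θ _
      refine ((Real.hasDerivAt_cos θ).mul
        (((Real.hasDerivAt_sin θ).const_mul x).sin)).congr_deriv ?_
      have := Real.sin_sq_add_cos_sq θ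
      linear_combination x * Real.cos (x * Real.sin θ) * this
    have hi := intervalIntegral.integral_eq_sub_of_hasDerivAt hd
      (Continuous.intervalIntegrable (by fun_prop) _ _)
    rw [intervalIntegral.integral_add (Continuous.intervalIntegrable (by fun_prop) _ _)
      (Continuous.intervalIntegrable (by fun_prop) _ _), intervalIntegral.integral_const_mul,
      intervalIntegral.integral_add (Continuous.intervalIntegrable (by fun_prop) _ _)
      (Continuous.intervalIntegrable (by fun_prop) _ _)] at hi
    simp only [Real.cos_pi_div_two, Real.sin_zero, mul_zero, zero_mul, sub_zero] at hi
    simp only [besselJZero]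
    linear_combination 2 / Real.pi * hi

/-! ### Moving the path of integration in the Poisson integral -/

/-- The integrand `e^(ixu) / √(1 - u²)` of the Poisson integral, holomorphic in the quarter plane
`0 ≤ Re u ≤ 1`, `0 < Im u`, where `1 - u²` stays off the branch cut. -/
noncomputable def poissonIntegrand (x : ℝ) (u : ℂ) : ℂ :=
  Complex.exp (Complex.I * x * u) * ((1 - u ^ 2) ^ (2⁻¹ : ℂ))⁻¹

lemma Complex.cpow_inv_two_sq (z : ℂ) : (z ^ (2⁻¹ : ℂ)) ^ 2 = z := by
  exact_mod_cast Complex.cpow_nat_inv_pow z two_ne_zero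

lemma Complex.norm_cpow_inv_two_sq (z : ℂ) : ‖z ^ (2⁻¹ : ℂ)‖ ^ 2 = ‖z‖ := by
  rw [← norm_pow, Complex.cpow_inv_two_sq]

lemma Complex.cpow_inv_two_re_nonneg (z : ℂ) : 0 ≤ (z ^ (2⁻¹ : ℂ)).re := by
  rw [Complex.cpow_inv_two_re]
  positivity

lemma one_sub_sq_re (a b : ℝ) : (1 - ((a : ℂ) + b * Complex.I) ^ 2).re = 1 - a ^ 2 + b ^ 2 := by
  simp [sq]
  ring

lemma one_sub_sq_mem_slitPlane {a b : ℝ} (ha : a ∈ Icc (0 : ℝ) 1) (hb : 0 < b) :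
    1 - ((a : ℂ) + b * Complex.I) ^ 2 ∈ Complex.slitPlane := by
  refine Or.inl ?_
  rw [one_sub_sq_re]
  nlinarith [ha.1, ha.2, sq_pos_of_pos hb]

lemma norm_poissonIntegrand (x a b : ℝ) :
    ‖poissonIntegrand x (a + b * Complex.I)‖
      = Real.exp (-(x * b)) * ‖(1 - ((a : ℂ) + b * Complex.I) ^ 2) ^ (2⁻¹ : ℂ)‖⁻¹ := by
  rw [poissonIntegrand, norm_mul, norm_inv, Complex.norm_exp]
  congr 2
  simp

lemma differentiableAt_poissonIntegrand (x : ℝ) {u : ℂ} (hu : 1 - u ^ 2 ∈ Complex.slitPlane) :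
    DifferentiableAt ℂ (poissonIntegrand x) u := by
  have h : (1 - u ^ 2) ^ (2⁻¹ : ℂ) ≠ 0 := by
    rw [Ne, Complex.cpow_eq_zero_iff]
    exact fun h => Complex.slitPlane_ne_zero hu h.1
  unfold poissonIntegrand
  refine DifferentiableAt.mul (by fun_prop) (DifferentiableAt.inv ?_ h)
  exact DifferentiableAt.cpow_const (by fun_prop) hu

lemma continuousOn_poissonIntegrand_horizontal (x : ℝ) {b : ℝ} (hb : 0 < b) :
    ContinuousOn (fun a : ℝ => poissonIntegrand x (a + b * Complex.I)) (Icc 0 1) := fun a ha =>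
  ((differentiableAt_poissonIntegrand x (one_sub_sq_mem_slitPlane ha hb)).continuousAt.comp
    (f := fun a : ℝ => (a : ℂ) + b * Complex.I) (by fun_prop)).continuousWithinAt

lemma continuousAt_poissonIntegrand_vertical (x : ℝ) {a b : ℝ} (ha : a ∈ Icc (0 : ℝ) 1)
    (hb : 0 < b) : ContinuousAt (fun b : ℝ => poissonIntegrand x (a + b * Complex.I)) b :=
  (differentiableAt_poissonIntegrand x (one_sub_sq_mem_slitPlane ha hb)).continuousAt.comp
    (f := fun b : ℝ => (a : ℂ) + b * Complex.I) (by fun_prop)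

/-- On the imaginary axis the integrand is real. -/
lemma poissonIntegrand_mul_I_im (x b : ℝ) :
    (poissonIntegrand x ((0 : ℝ) + b * Complex.I)).im = 0 := by
  have h : poissonIntegrand x ((0 : ℝ) + b * Complex.I)
      = ((Real.exp (-(x * b)) * ((1 + b ^ 2) ^ (2⁻¹ : ℝ))⁻¹ : ℝ) : ℂ) := by
    rw [poissonIntegrand]
    push_cast [Complex.ofReal_cpow (show (0 : ℝ) ≤ 1 + b ^ 2 by positivity)]
    congr 2
    · linear_combination x * b * Complex.I_sq
    · congr 1
      linear_combination -(b : ℂ) ^ 2 * Complex.I_sq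
  rw [h, Complex.ofReal_im]

/-- Cauchy's theorem on the rectangle `[0, 1] × [ε, T]`, with the vertical side on the imaginary
axis removed by taking real parts. -/
lemma re_integral_poissonIntegrand (x : ℝ) {ε T : ℝ} (hε : 0 < ε) (hT : ε ≤ T) :
    (∫ a in (0 : ℝ)..1, poissonIntegrand x (a + ε * Complex.I)).re
      = (∫ a in (0 : ℝ)..1, poissonIntegrand x (a + T * Complex.I)).re
        + (-Complex.I * ∫ b in ε..T, poissonIntegrand x ((1 : ℝ) + b * Complex.I)).re := by
  have h := Complex.integral_boundary_rect_eq_zero_of_differentiableOn (poissonIntegrand x)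
    (ε * Complex.I) (1 + T * Complex.I) ?_
  · simp only [Complex.mul_re, Complex.mul_im, Complex.ofReal_re, Complex.ofReal_im, Complex.I_re,
      Complex.I_im, Complex.add_re, Complex.add_im, Complex.one_re, Complex.one_im, mul_zero,
      mul_one, add_zero, zero_add, sub_zero, smul_eq_mul] at h
    have him : (Complex.I * ∫ b in ε..T, poissonIntegrand x ((0 : ℝ) + b * Complex.I)).re = 0 := by
      have hint : IntervalIntegrable (fun b : ℝ => poissonIntegrand x ((0 : ℝ) + b * Complex.I))
          volume ε T := by
        refine ContinuousOn.intervalIntegrable_of_Icc hT fun b hb => ?_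
        exact (continuousAt_poissonIntegrand_vertical x (by simp)
          (hε.trans_le hb.1)).continuousWithinAt
      have h1 : (∫ b in ε..T, poissonIntegrand x ((0 : ℝ) + b * Complex.I)).im
          = ∫ b in ε..T, (poissonIntegrand x ((0 : ℝ) + b * Complex.I)).im :=
        (Complex.imCLM.intervalIntegral_comp_comm hint).symm
      simp only [poissonIntegrand_mul_I_im, intervalIntegral.integral_zero] at h1
      rw [Complex.mul_re, h1]
      simp
    have h2 := congrArg Complex.re h
    simp only [Complex.sub_re, Complex.add_re, Complex.zero_re] at h2
    rw [him] at h2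
    rw [neg_mul, Complex.neg_re]
    linarith
  · intro u hu
    rw [Complex.mem_reProdIm] at hu
    simp only [Complex.mul_re, Complex.mul_im, Complex.ofReal_re, Complex.ofReal_im, Complex.I_re,
      Complex.I_im, Complex.add_re, Complex.add_im, Complex.one_re, Complex.one_im, mul_zero,
      mul_one, add_zero, zero_add, sub_zero, uIcc_of_le hT,
      uIcc_of_le (zero_le_one (α := ℝ))] at hu
    refine (differentiableAt_poissonIntegrand x ?_).differentiableWithinAt
    rw [← Complex.re_add_im u]
    exact one_sub_sq_mem_slitPlane hu.1 (hε.trans_le hu.2.1)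

lemma norm_integral_poissonIntegrand_le (x : ℝ) {T : ℝ} (hx : 0 < x) (hT : 0 < T) :
    ‖∫ a in (0 : ℝ)..1, poissonIntegrand x (a + T * Complex.I)‖ ≤ T⁻¹ := by
  have h := intervalIntegral.norm_integral_le_of_norm_le_const (a := 0) (b := 1) (C := T⁻¹)
    (f := fun a : ℝ => poissonIntegrand x (a + T * Complex.I)) ?_
  · simpa using h
  intro a ha
  rw [uIoc_of_le zero_le_one] at ha
  rw [norm_poissonIntegrand]
  have h1 : T ≤ ‖(1 - ((a : ℂ) + T * Complex.I) ^ 2) ^ (2⁻¹ : ℂ)‖ := by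
    refine (sq_le_sq₀ hT.le (norm_nonneg _)).1 ?_
    rw [Complex.norm_cpow_inv_two_sq]
    refine le_trans ?_ (Complex.re_le_norm _)
    rw [one_sub_sq_re]
    nlinarith [ha.1, ha.2]
  have h2 : Real.exp (-(x * T)) ≤ 1 := Real.exp_le_one_iff.2 (by nlinarith)
  calc _ ≤ 1 * T⁻¹ := by gcongr
    _ = T⁻¹ := one_mul _

/-- As the bottom side of the rectangle descends to the real axis, its integral tends to the Poisson
integral. The substitution `a = sin θ` makes the integrands uniformly bounded. -/
lemma tendsto_re_integral_poissonIntegrand {x : ℝ} (hx : 0 < x) :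
    Tendsto (fun ε : ℝ => (∫ a in (0 : ℝ)..1, poissonIntegrand x (a + ε * Complex.I)).re)
      (𝓝[>] 0) (𝓝 (Real.pi / 2 * besselJZero x)) := by
  have hpi := Real.pi_pos
  have hmem : ∀ θ ∈ Icc 0 (Real.pi / 2), Real.sin θ ∈ Icc (0 : ℝ) 1 := fun θ hθ =>
    ⟨Real.sin_nonneg_of_nonneg_of_le_pi hθ.1 (by linarith [hθ.2]), Real.sin_le_one θ⟩
  have hsub : ∀ ε : ℝ, 0 < ε → ∫ a in (0 : ℝ)..1, poissonIntegrand x (a + ε * Complex.I)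
      = ∫ θ in (0 : ℝ)..Real.pi / 2,
        Real.cos θ • poissonIntegrand x (Real.sin θ + ε * Complex.I) := by
    intro ε hε
    have := intervalIntegral.integral_deriv_smul_comp'' (a := 0) (b := Real.pi / 2)
      (f := Real.sin) (f' := Real.cos)
      (g := fun a : ℝ => poissonIntegrand x (a + ε * Complex.I)) (by fun_prop)
      (fun θ _ => (Real.hasDerivAt_sin θ).hasDerivWithinAt) (by fun_prop) ?_
    · simpa using this.symm
    · refine (continuousOn_poissonIntegrand_horizontal x hε).mono ?_
      rw [uIcc_of_le (by positivity)]
      rintro _ ⟨θ, hθ, rfl⟩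
      exact hmem θ hθ
  have hlim : Tendsto (fun ε : ℝ => ∫ θ in (0 : ℝ)..Real.pi / 2,
      Real.cos θ • poissonIntegrand x (Real.sin θ + ε * Complex.I)) (𝓝[>] 0)
      (𝓝 (∫ θ in (0 : ℝ)..Real.pi / 2, Complex.exp (Complex.I * x * Real.sin θ))) := by
    refine intervalIntegral.tendsto_integral_filter_of_dominated_convergence (fun _ => 1) ?_ ?_
      intervalIntegrable_const ?_
    · filter_upwards [self_mem_nhdsWithin] with ε hε
      rw [uIoc_of_le (by positivity)]
      refine ContinuousOn.aestronglyMeasurable ?_ measurableSet_Ioc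
      refine Real.continuous_cos.continuousOn.fun_smul ?_
      exact (continuousOn_poissonIntegrand_horizontal x hε).comp Real.continuous_sin.continuousOn
        fun θ hθ => hmem θ (Ioc_subset_Icc_self hθ)
    · filter_upwards [self_mem_nhdsWithin] with ε hε
      refine Eventually.of_forall fun θ hθ => ?_
      rw [uIoc_of_le (by positivity)] at hθ
      have hε : 0 < ε := hε
      have hc : 0 ≤ Real.cos θ := Real.cos_nonneg_of_neg_pi_div_two_le_of_le (by linarith [hθ.1]) hθ.2
      rw [norm_smul, norm_poissonIntegrand, Real.norm_eq_abs, abs_of_nonneg hc]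
      have h1 : Real.cos θ ≤ ‖(1 - ((Real.sin θ : ℂ) + ε * Complex.I) ^ 2) ^ (2⁻¹ : ℂ)‖ := by
        refine (sq_le_sq₀ hc (norm_nonneg _)).1 ?_
        rw [Complex.norm_cpow_inv_two_sq]
        refine le_trans ?_ (Complex.re_le_norm _)
        rw [one_sub_sq_re, Real.cos_sq']
        nlinarith
      have h2 : Real.exp (-(x * ε)) ≤ 1 := Real.exp_le_one_iff.2 (by nlinarith)
      calc _ ≤ Real.cos θ * (1 * ‖(1 - ((Real.sin θ : ℂ) + ε * Complex.I) ^ 2) ^ (2⁻¹ : ℂ)‖⁻¹) := by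
            gcongr
        _ = Real.cos θ / ‖(1 - ((Real.sin θ : ℂ) + ε * Complex.I) ^ 2) ^ (2⁻¹ : ℂ)‖ := by ring
        _ ≤ 1 := div_le_one_of_le₀ h1 (norm_nonneg _)
    · have hne : ∀ᵐ θ : ℝ, θ ≠ Real.pi / 2 := by
        simp [ae_iff, measure_singleton]
      filter_upwards [hne] with θ hθ' hθ
      rw [uIoc_of_le (by positivity)] at hθ
      have hc : 0 < Real.cos θ :=
        Real.cos_pos_of_mem_Ioo ⟨by linarith [hθ.1], lt_of_le_of_ne hθ.2 hθ'⟩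
      have hsq : (1 : ℂ) - ((Real.sin θ : ℂ) + (0 : ℝ) * Complex.I) ^ 2
          = ((Real.cos θ ^ 2 : ℝ) : ℂ) := by
        rw [Real.cos_sq']
        push_cast
        ring
      have hcont : ContinuousAt
          (fun ε : ℝ => Real.cos θ • poissonIntegrand x (Real.sin θ + ε * Complex.I)) 0 := by
        refine continuousAt_const.fun_smul ?_
        refine ContinuousAt.comp (g := poissonIntegrand x)
          (f := fun ε : ℝ => (Real.sin θ : ℂ) + ε * Complex.I) ?_ (by fun_prop)
        refine (differentiableAt_poissonIntegrand x ?_).continuousAt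
        rw [hsq]
        exact Complex.ofReal_mem_slitPlane.2 (by positivity)
      have hval : Real.cos θ • poissonIntegrand x (Real.sin θ + (0 : ℝ) * Complex.I)
          = Complex.exp (Complex.I * x * Real.sin θ) := by
        have hroot : ((Real.cos θ ^ 2 : ℝ) : ℂ) ^ (2⁻¹ : ℂ) = Real.cos θ := by
          rw [show (2⁻¹ : ℂ) = ((2⁻¹ : ℝ) : ℂ) by push_cast; rfl,
            ← Complex.ofReal_cpow (by positivity), ← Real.rpow_natCast, ← Real.rpow_mul hc.le]
          norm_num
        rw [poissonIntegrand, hsq, hroot, Complex.real_smul, Complex.ofReal_zero, zero_mul,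
          add_zero]
        have : (Real.cos θ : ℂ) ≠ 0 := by exact_mod_cast hc.ne'
        field_simp
      rw [← hval]
      exact hcont.tendsto.mono_left nhdsWithin_le_nhds
  have hre : (∫ θ in (0 : ℝ)..Real.pi / 2, Complex.exp (Complex.I * x * Real.sin θ)).re
      = Real.pi / 2 * besselJZero x := by
    have h1 : (∫ θ in (0 : ℝ)..Real.pi / 2, Complex.exp (Complex.I * x * Real.sin θ)).re
        = ∫ θ in (0 : ℝ)..Real.pi / 2, (Complex.exp (Complex.I * x * Real.sin θ)).re :=
      (Complex.reCLM.intervalIntegral_comp_comm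
        (Continuous.intervalIntegrable (by fun_prop) _ _)).symm
    have h2 : ∀ θ : ℝ, (Complex.exp (Complex.I * x * Real.sin θ)).re
        = Real.cos (x * Real.sin θ) := fun θ => by
      rw [show Complex.I * x * Real.sin θ = ((x * Real.sin θ : ℝ) : ℂ) * Complex.I by
        push_cast; ring, Complex.exp_ofReal_mul_I_re]
    rw [h1, besselJZero]
    simp only [h2]
    field_simp
  rw [← hre]
  refine ((Complex.continuous_re.tendsto _).comp hlim).congr' ?_
  filter_upwards [self_mem_nhdsWithin] with ε hε
  simp only [Function.comp_apply]
  rw [hsub ε hε]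

/-! ### Asymptotics of the Bessel function -/

/-- On the vertical line `Re u = 1` one has `1 - u² = -2ib + b²`, whose square root is compared with
`√b (1 - i)`. -/
lemma norm_cpow_inv_two_inv_sub_le {b : ℝ} (hb : 0 < b) :
    ‖((1 - (((1 : ℝ) : ℂ) + b * Complex.I) ^ 2) ^ (2⁻¹ : ℂ))⁻¹
      - (1 + Complex.I) / 2 * ((√b : ℝ) : ℂ)⁻¹‖ ≤ √b / 2 := by
  set r := √b with hr
  have hr0 : 0 < r := Real.sqrt_pos.2 hb
  have hbr : b = r ^ 2 := (Real.sq_sqrt hb.le).symm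
  have hbrC : (b : ℂ) = (r : ℂ) ^ 2 := by rw [hbr]; push_cast; rfl
  have hrC : (r : ℂ) ≠ 0 := by exact_mod_cast hr0.ne'
  set s := (1 - (((1 : ℝ) : ℂ) + b * Complex.I) ^ 2) ^ (2⁻¹ : ℂ) with hs
  set t : ℂ := r * (1 - Complex.I) with ht
  have hs2 : s ^ 2 = (b : ℂ) ^ 2 - 2 * b * Complex.I := by
    rw [hs, Complex.cpow_inv_two_sq]
    push_cast
    linear_combination -(b : ℂ) ^ 2 * Complex.I_sq
  have ht2 : t ^ 2 = -2 * b * Complex.I := by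
    rw [ht, hbrC]
    linear_combination (r : ℂ) ^ 2 * Complex.I_sq
  have hst : (s - t) * (s + t) = ((b ^ 2 : ℝ) : ℂ) := by
    push_cast
    linear_combination hs2 - ht2
  have hsum : r ≤ ‖s + t‖ := by
    refine le_trans ?_ (Complex.re_le_norm _)
    have : 0 ≤ s.re := Complex.cpow_inv_two_re_nonneg _
    rw [Complex.add_re]
    have h2 : t.re = r := by simp [ht]
    rw [h2]
    linarith
  have hdiff : ‖s - t‖ * r ≤ b ^ 2 := by
    calc ‖s - t‖ * r ≤ ‖s - t‖ * ‖s + t‖ := by gcongr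
      _ = b ^ 2 := by
        rw [← norm_mul, hst, Complex.norm_real, Real.norm_eq_abs, abs_of_nonneg (by positivity)]
  have hns : 2 * b ≤ ‖s‖ ^ 2 := by
    rw [← norm_pow, hs2]
    refine le_trans ?_ (Complex.abs_im_le_norm _)
    have : ((b : ℂ) ^ 2 - 2 * b * Complex.I).im = -(2 * b) := by
      simp [sq]
    rw [this, abs_neg]
    exact le_abs_self _
  have hnt : 2 * b = ‖t‖ ^ 2 := by
    rw [← norm_pow, ht2]
    simp [abs_of_pos hb]
  have hs0 : 0 < ‖s‖ := by
    rcases (norm_nonneg s).eq_or_lt with h | h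
    · rw [← h] at hns; nlinarith
    · exact h
  have ht0 : 0 < ‖t‖ := by
    rcases (norm_nonneg t).eq_or_lt with h | h
    · rw [← h] at hnt; nlinarith
    · exact h
  have hprod : 2 * b ≤ ‖s‖ * ‖t‖ := by
    have : ‖t‖ ≤ ‖s‖ := (sq_le_sq₀ ht0.le hs0.le).1 (hnt ▸ hns)
    nlinarith
  have htinv : (1 + Complex.I) / 2 * (r : ℂ)⁻¹ = t⁻¹ := by
    have htne : t ≠ 0 := norm_pos_iff.1 ht0
    refine eq_inv_of_mul_eq_one_left ?_
    rw [ht]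
    field_simp
    linear_combination -Complex.I_sq
  rw [htinv, inv_sub_inv (norm_pos_iff.1 hs0) (norm_pos_iff.1 ht0), norm_div, norm_mul,
    norm_sub_rev, div_le_iff₀ (by positivity)]
  have h1 : ‖s - t‖ ≤ r ^ 3 := by
    rw [hbr] at hdiff
    refine le_of_mul_le_mul_right ?_ hr0
    linarith
  have h2 : r / 2 * (2 * b) ≤ r / 2 * (‖s‖ * ‖t‖) := by gcongr
  have h3 : r / 2 * (2 * b) = r ^ 3 := by rw [hbr]; ring
  linarith

/-- Leading behaviour of the Poisson integrand near the branch point `u = 1`. -/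
lemma norm_poissonIntegrand_one_sub_le (x : ℝ) {b : ℝ} (hb : 0 < b) :
    ‖poissonIntegrand x ((1 : ℝ) + b * Complex.I) - Complex.exp (x * Complex.I)
        * ((1 + Complex.I) / 2) * ((b ^ ((1 / 2 : ℝ) - 1) * Real.exp (-(x * b)) : ℝ) : ℂ)‖
      ≤ 1 / 2 * (b ^ ((3 / 2 : ℝ) - 1) * Real.exp (-(x * b))) := by
  have h1 : b ^ ((1 / 2 : ℝ) - 1) = (√b)⁻¹ := by
    rw [Real.sqrt_eq_rpow, ← Real.rpow_neg hb.le]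
    norm_num
  have h2 : b ^ ((3 / 2 : ℝ) - 1) = √b := by
    rw [Real.sqrt_eq_rpow]
    norm_num
  have h3 : Complex.exp (Complex.I * x * ((1 : ℝ) + b * Complex.I))
      = Complex.exp (x * Complex.I) * ((Real.exp (-(x * b)) : ℝ) : ℂ) := by
    push_cast
    rw [← Complex.exp_add]
    congr 1
    linear_combination (x * b : ℂ) * Complex.I_sq
  rw [h1, h2, poissonIntegrand, h3]
  set s := (1 - (((1 : ℝ) : ℂ) + b * Complex.I) ^ 2) ^ (2⁻¹ : ℂ) with hs
  have h4 : Complex.exp (x * Complex.I) * ((Real.exp (-(x * b)) : ℝ) : ℂ) * s⁻¹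
      - Complex.exp (x * Complex.I) * ((1 + Complex.I) / 2)
        * (((√b)⁻¹ * Real.exp (-(x * b)) : ℝ) : ℂ)
      = Complex.exp (x * Complex.I) * ((Real.exp (-(x * b)) : ℝ) : ℂ)
        * (s⁻¹ - (1 + Complex.I) / 2 * ((√b : ℝ) : ℂ)⁻¹) := by
    push_cast
    ring
  rw [h4, norm_mul, norm_mul, Complex.norm_exp_ofReal_mul_I, Complex.norm_real, Real.norm_eq_abs,
    Real.abs_exp]
  have h5 := norm_cpow_inv_two_inv_sub_le hb
  calc 1 * Real.exp (-(x * b)) * ‖s⁻¹ - (1 + Complex.I) / 2 * ((√b : ℝ) : ℂ)⁻¹‖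
      ≤ 1 * Real.exp (-(x * b)) * (√b / 2) := by gcongr
    _ = 1 / 2 * (√b * Real.exp (-(x * b))) := by ring

lemma integrableOn_rpow_mul_exp_neg_mul {a x : ℝ} (ha : 0 < a) (hx : 0 < x) :
    IntegrableOn (fun b : ℝ => b ^ (a - 1) * Real.exp (-(x * b))) (Ioi 0) := by
  simpa using integrableOn_rpow_mul_exp_neg_mul_rpow (p := 1) (s := a - 1) (b := x)
    (by linarith) one_pos hx

lemma abs_re_integral_poissonIntegrand_sub_le {x ε T : ℝ} (hx : 0 < x) (hε : 0 < ε) (hT : ε ≤ T) :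
    |(∫ a in (0 : ℝ)..1, poissonIntegrand x (a + ε * Complex.I)).re
        - (Real.cos x + Real.sin x) / 2
          * ∫ b in ε..T, b ^ ((1 / 2 : ℝ) - 1) * Real.exp (-(x * b))|
      ≤ T⁻¹ + 1 / 2 * ∫ b in Ioi (0 : ℝ), b ^ ((3 / 2 : ℝ) - 1) * Real.exp (-(x * b)) := by
  have hsub : Ioc ε T ⊆ Ioi 0 := fun b hb => hε.trans hb.1
  have hint : ∀ a : ℝ, 0 < a → IntervalIntegrable
      (fun b : ℝ => b ^ (a - 1) * Real.exp (-(x * b))) volume ε T := fun a ha =>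
    (intervalIntegrable_iff_integrableOn_Ioc_of_le hT).2
      ((integrableOn_rpow_mul_exp_neg_mul ha hx).mono_set hsub)
  have hintC : IntervalIntegrable
      (fun b : ℝ => ((b ^ ((1 / 2 : ℝ) - 1) * Real.exp (-(x * b)) : ℝ) : ℂ)) volume ε T :=
    ⟨(hint (1 / 2) (by norm_num)).1.ofReal, (hint (1 / 2) (by norm_num)).2.ofReal⟩
  have hfint : IntervalIntegrable (fun b : ℝ => poissonIntegrand x ((1 : ℝ) + b * Complex.I))
      volume ε T := by
    refine ContinuousOn.intervalIntegrable_of_Icc hT fun b hb => ?_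
    exact (continuousAt_poissonIntegrand_vertical x (by simp)
      (hε.trans_le hb.1)).continuousWithinAt
  set c : ℂ := Complex.exp (x * Complex.I) * ((1 + Complex.I) / 2) with hc
  set A : ℝ := ∫ b in ε..T, b ^ ((1 / 2 : ℝ) - 1) * Real.exp (-(x * b)) with hA
  have hdiff : ‖(∫ b in ε..T, poissonIntegrand x ((1 : ℝ) + b * Complex.I)) - c * (A : ℂ)‖
      ≤ 1 / 2 * ∫ b in Ioi (0 : ℝ), b ^ ((3 / 2 : ℝ) - 1) * Real.exp (-(x * b)) := by
    have h1 : (∫ b in ε..T, poissonIntegrand x ((1 : ℝ) + b * Complex.I)) - c * (A : ℂ)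
        = ∫ b in ε..T, (poissonIntegrand x ((1 : ℝ) + b * Complex.I)
          - c * ((b ^ ((1 / 2 : ℝ) - 1) * Real.exp (-(x * b)) : ℝ) : ℂ)) := by
      rw [intervalIntegral.integral_sub hfint (hintC.const_mul c),
        intervalIntegral.integral_const_mul, intervalIntegral.integral_ofReal]
    rw [h1]
    refine (intervalIntegral.norm_integral_le_of_norm_le hT (Eventually.of_forall fun b hb =>
      norm_poissonIntegrand_one_sub_le x (hsub hb))
      ((hint (3 / 2) (by norm_num)).const_mul (1 / 2))).trans ?_
    rw [intervalIntegral.integral_const_mul, intervalIntegral.integral_of_le hT]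
    refine mul_le_mul_of_nonneg_left ?_ (by norm_num)
    refine setIntegral_mono_set (integrableOn_rpow_mul_exp_neg_mul (a := 3 / 2) (by norm_num) hx) ?_
      hsub.eventuallyLE
    filter_upwards [ae_restrict_mem measurableSet_Ioi] with b hb
    have hb : 0 < b := hb
    simp only [Pi.zero_apply]
    positivity
  have hcre : (-Complex.I * (c * (A : ℂ))).re = (Real.cos x + Real.sin x) / 2 * A := by
    have : -Complex.I * (c * (A : ℂ)) = ((A / 2 : ℝ) : ℂ)
        * (Complex.exp (x * Complex.I) * (1 - Complex.I)) := by
      rw [hc]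
      push_cast
      linear_combination (-(A : ℂ) / 2 * Complex.exp (x * Complex.I)) * Complex.I_sq
    rw [this, Complex.re_ofReal_mul, Complex.mul_re, Complex.exp_ofReal_mul_I_re,
      Complex.exp_ofReal_mul_I_im]
    simp
    ring
  rw [re_integral_poissonIntegrand x hε hT, ← hcre, add_sub_assoc, ← Complex.sub_re, ← mul_sub]
  refine (abs_add_le _ _).trans (add_le_add ?_ ?_)
  · exact (Complex.abs_re_le_norm _).trans
      (norm_integral_poissonIntegrand_le x hx (hε.trans_le hT))
  · refine (Complex.abs_re_le_norm _).trans ?_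
    rw [norm_mul, norm_neg, Complex.norm_I, one_mul]
    exact hdiff

lemma tendsto_intervalIntegral_of_integrableOn_Ioi {f : ℝ → ℝ} (hf : IntegrableOn f (Ioi 0)) :
    Tendsto (fun k : ℕ => ∫ b in (1 / ((k : ℝ) + 1))..(k + 1), f b) atTop
      (𝓝 (∫ b in Ioi 0, f b)) := by
  have hF : Integrable ((Ioi (0 : ℝ)).indicator f) := (integrable_indicator_iff measurableSet_Ioi).2 hf
  have hI : ∀ a b, IntervalIntegrable ((Ioi (0 : ℝ)).indicator f) volume a b :=
    fun a b => hF.intervalIntegrable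
  have h1 : Tendsto (fun k : ℕ => ∫ b in (0 : ℝ)..(k + 1), (Ioi (0 : ℝ)).indicator f b) atTop
      (𝓝 (∫ b in Ioi 0, (Ioi (0 : ℝ)).indicator f b)) :=
    intervalIntegral_tendsto_integral_Ioi 0 hF.integrableOn
      (tendsto_atTop_add_const_right _ _ tendsto_natCast_atTop_atTop)
  have h2 : Tendsto (fun k : ℕ => ∫ b in (0 : ℝ)..(1 / ((k : ℝ) + 1)), (Ioi (0 : ℝ)).indicator f b)
      atTop (𝓝 0) := by
    have := ((intervalIntegral.continuous_primitive hI 0).tendsto 0).comp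
      (tendsto_one_div_add_atTop_nhds_zero_nat (𝕜 := ℝ))
    rw [intervalIntegral.integral_same] at this
    exact this
  have h3 := h1.sub h2
  rw [setIntegral_indicator measurableSet_Ioi, inter_self, sub_zero] at h3
  refine h3.congr fun k => ?_
  rw [intervalIntegral.integral_interval_sub_left (hI _ _) (hI _ _)]
  have hk : (1 : ℝ) / (k + 1) ≤ k + 1 := by
    rw [div_le_iff₀ (by positivity)]
    nlinarith [(Nat.cast_nonneg k : (0 : ℝ) ≤ k)]
  refine intervalIntegral.integral_congr fun b hb => ?_
  rw [uIcc_of_le hk] at hb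
  exact indicator_of_mem (lt_of_lt_of_le (by positivity) hb.1) _

/-- Hankel's asymptotic formula for `J₀` with an explicit error. -/
lemma abs_sqrt_mul_besselJZero_sub_le {x : ℝ} (hx : 0 < x) :
    |√x * besselJZero x - (Real.cos x + Real.sin x) / √Real.pi| ≤ 1 / (2 * √Real.pi * x) := by
  set B : ℝ := ∫ b in Ioi (0 : ℝ), b ^ ((3 / 2 : ℝ) - 1) * Real.exp (-(x * b)) with hB
  have hlim : |Real.pi / 2 * besselJZero x - (Real.cos x + Real.sin x) / 2
      * ∫ b in Ioi (0 : ℝ), b ^ ((1 / 2 : ℝ) - 1) * Real.exp (-(x * b))| ≤ 0 + 1 / 2 * B := by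
    have hk : Tendsto (fun k : ℕ => 1 / ((k : ℝ) + 1)) atTop (𝓝[>] 0) :=
      tendsto_nhdsWithin_iff.2 ⟨tendsto_one_div_add_atTop_nhds_zero_nat,
        Eventually.of_forall fun k => by simp only [mem_Ioi]; positivity⟩
    have h1 := ((tendsto_re_integral_poissonIntegrand hx).comp hk).sub
      ((tendsto_intervalIntegral_of_integrableOn_Ioi
        (integrableOn_rpow_mul_exp_neg_mul (a := 1 / 2) (by norm_num) hx)).const_mul
          ((Real.cos x + Real.sin x) / 2))
    have h2 : Tendsto (fun k : ℕ => ((k : ℝ) + 1)⁻¹ + 1 / 2 * B) atTop (𝓝 (0 + 1 / 2 * B)) := by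
      refine Tendsto.add_const _ ?_
      simpa using tendsto_one_div_add_atTop_nhds_zero_nat (𝕜 := ℝ)
    refine le_of_tendsto_of_tendsto' h1.abs h2 fun k => ?_
    refine abs_re_integral_poissonIntegrand_sub_le hx (by positivity) ?_
    rw [div_le_iff₀ (by positivity)]
    nlinarith [(Nat.cast_nonneg k : (0 : ℝ) ≤ k)]
  have hpi : 0 < √Real.pi := Real.sqrt_pos.2 Real.pi_pos
  have hsx : 0 < √x := Real.sqrt_pos.2 hx
  have hG : Real.Gamma (3 / 2) = √Real.pi / 2 := by
    rw [show (3 / 2 : ℝ) = 1 / 2 + 1 by norm_num, Real.Gamma_add_one (by norm_num),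
      Real.Gamma_one_half_eq]
    ring
  have hp1 : (1 / x) ^ (1 / 2 : ℝ) = (√x)⁻¹ := by
    rw [← Real.sqrt_eq_rpow, one_div, Real.sqrt_inv]
  have hp2 : (1 / x) ^ (3 / 2 : ℝ) = (√x)⁻¹ / x := by
    rw [show (3 / 2 : ℝ) = 1 / 2 + 1 by norm_num, Real.rpow_add (by positivity), hp1,
      Real.rpow_one]
    ring
  rw [hB, Real.integral_rpow_mul_exp_neg_mul_Ioi (by norm_num) hx,
    Real.integral_rpow_mul_exp_neg_mul_Ioi (by norm_num) hx, Real.Gamma_one_half_eq, hG, hp1,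
    hp2] at hlim
  have hpi2 : Real.pi = √Real.pi ^ 2 := (Real.sq_sqrt Real.pi_pos.le).symm
  have hfac : √x * besselJZero x - (Real.cos x + Real.sin x) / √Real.pi
      = 2 * √x / Real.pi * (Real.pi / 2 * besselJZero x
        - (Real.cos x + Real.sin x) / 2 * ((√x)⁻¹ * √Real.pi)) := by
    rw [mul_sub]
    congr 1
    · field_simp
    · rw [hpi2, Real.sqrt_sq hpi.le]
      field_simp
  have hpos : 0 < 2 * √x / Real.pi := by positivity
  rw [hfac, abs_mul, abs_of_pos hpos]
  calc _ ≤ 2 * √x / Real.pi * (0 + 1 / 2 * ((√x)⁻¹ / x * (√Real.pi / 2))) := by gcongr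
    _ = 1 / (2 * √Real.pi * x) := by
      rw [hpi2, Real.sqrt_sq hpi.le]
      field_simp
      ring

lemma inv_sqrt_pi_le : (√Real.pi)⁻¹ ≤ 0.565 := by
  have h : (1.77 : ℝ) ≤ √Real.pi := Real.le_sqrt_of_sq_le (by nlinarith [Real.pi_gt_d4])
  calc (√Real.pi)⁻¹ ≤ (1.77 : ℝ)⁻¹ := by gcongr
    _ ≤ 0.565 := by norm_num

lemma abs_cos_add_sin_le (x : ℝ) : |Real.cos x + Real.sin x| ≤ 1.415 := by
  refine abs_le_of_sq_le_sq ?_ (by norm_num)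
  nlinarith [Real.sin_sq_add_cos_sq x, sq_nonneg (Real.cos x - Real.sin x)]

lemma sqrt_mul_abs_besselJZero_le (x : ℝ) : √x * |besselJZero x| ≤ 1.1 := by
  rcases le_total x 1 with h | h
  · have h1 : √x ≤ 1 := Real.sqrt_le_one.2 h
    have := mul_le_one₀ h1 (abs_nonneg _) (abs_besselJZero_le_one x)
    linarith
  · have h0 : 0 < x := by linarith
    have hpi : 0 < √Real.pi := Real.sqrt_pos.2 Real.pi_pos
    have h1 := abs_sqrt_mul_besselJZero_sub_le h0
    have h2 : 1 / (2 * √Real.pi * x) ≤ (√Real.pi)⁻¹ / 2 := by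
      rw [div_le_iff₀ (by positivity)]
      field_simp
      linarith
    have h3 : |(Real.cos x + Real.sin x) / √Real.pi| ≤ 1.415 * (√Real.pi)⁻¹ := by
      rw [abs_div, abs_of_pos hpi, div_eq_mul_inv]
      gcongr
      exact abs_cos_add_sin_le x
    have h4 := abs_sub_abs_le_abs_sub (√x * besselJZero x)
      ((Real.cos x + Real.sin x) / √Real.pi)
    rw [abs_mul, abs_of_nonneg (Real.sqrt_nonneg x)] at h4
    linarith [inv_sqrt_pi_le]

/-! ### Comparison of Laguerre polynomials with the Bessel function -/

/-- Comparison of `v(s) = e^(-s²/2) L_n(s²)` with `J₀(κs)`, `κ = q² = 2√n`, at `s = 1`. The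
difference solves an inhomogeneous Bessel equation with right-hand side `(s² - 2) v`. -/
lemma pow_three_mul_abs_laguerreL_sub_besselJZero_le {n : ℕ} {q : ℝ} (hq : 0 < q)
    (hqn : (q ^ 2) ^ 2 = 4 * n) (hq2 : 3.46 ≤ q ^ 2) :
    q ^ 3 * |Real.exp (-1 / 2) * laguerreL n 1 - besselJZero (q ^ 2)| ≤ 3.54 := by
  obtain ⟨v', v'', hv1, hv2, hvode⟩ := exists_laguerreL_sq_deriv_ode n
  obtain ⟨J', J'', hJ1, hJ2, hJode⟩ := exists_besselJZero_deriv_ode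
  set v : ℝ → ℝ := fun s => Real.exp (-s ^ 2 / 2) * laguerreL n (s ^ 2) with hv
  have hlin : ∀ s : ℝ, HasDerivAt (fun s => q ^ 2 * s) (q ^ 2) s := fun s => by
    simpa using (hasDerivAt_id s).const_mul (q ^ 2)
  have hvc : Continuous v := continuous_iff_continuousAt.2 fun s => (hv1 s).continuousAt
  obtain ⟨t, ht, hmax⟩ := isCompact_Icc.exists_isMaxOn (nonempty_Icc.2 (zero_le_one (α := ℝ)))
    (f := fun s => √s * |v s|) (by fun_prop)
  set m := √t * |v t| with hm
  have hm0 : 0 ≤ m := by positivity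
  have henergy : ∀ s ∈ Icc (0 : ℝ) 1,
      q ^ 2 * (√s * |v s - besselJZero (q ^ 2 * s)|) ≤ 5 / 3 * m := by
    intro s hs
    have := mul_sqrt_mul_abs_le_of_bessel_ode (κ := q ^ 2)
      (D := fun s => v s - besselJZero (q ^ 2 * s))
      (D' := fun s => v' s - J' (q ^ 2 * s) * q ^ 2)
      (D'' := fun s => v'' s - J'' (q ^ 2 * s) * q ^ 2 * q ^ 2)
      (F := fun s => (s ^ 2 - 2) * v s) (p := fun s => (2 - s ^ 2) * m)
      (P := fun s => (2 * s - s ^ 3 / 3) * m) (by positivity)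
      (fun s => (hv1 s).sub (HasDerivAt.comp (h₂ := besselJZero) s (hJ1 _) (hlin s)))
      (fun s => (hv2 s).sub ((HasDerivAt.comp (h₂ := J') s (hJ2 _) (hlin s)).mul_const _))
      (fun s _ => ?_) ?_ (fun s => ?_) (by simp) (fun s hs => ?_) hs
    · refine this.trans ?_
      gcongr
      -- `s³ - 6s + 5 = (1 - s)(5 - s - s²)`
      nlinarith [mul_nonneg (sub_nonneg.2 hs.2) (show 0 ≤ 5 - s - s ^ 2 by nlinarith [hs.1, hs.2])]
    · linear_combination hvode s - q ^ 2 * hJode (q ^ 2 * s) + s * v s * hqn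
    · simp [hv, laguerreL_zero_right, besselJZero_zero]
    · refine ((((hasDerivAt_id s).const_mul 2).sub
        ((hasDerivAt_pow 3 s).div_const 3)).mul_const m).congr_deriv ?_
      simp
    · have h1 : |(s ^ 2 - 2) * v s| = (2 - s ^ 2) * |v s| := by
        rw [abs_mul, abs_sub_comm, abs_of_nonneg (by nlinarith [hs.1, hs.2])]
      have h2 : √s * |v s| ≤ m := hmax (Ioo_subset_Icc_self hs)
      rw [h1]
      have h3 : 0 ≤ 2 - s ^ 2 := by nlinarith [hs.1, hs.2]
      nlinarith
  have hqm : q ^ 2 * m ≤ 1.1 * q + 5 / 3 * m := by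
    have h1 := henergy t ht
    have h2 := sqrt_mul_abs_besselJZero_le (q ^ 2 * t)
    rw [Real.sqrt_mul (by positivity), Real.sqrt_sq hq.le] at h2
    have h3 : |v t| ≤ |v t - besselJZero (q ^ 2 * t)| + |besselJZero (q ^ 2 * t)| := by
      have := abs_add_le (v t - besselJZero (q ^ 2 * t)) (besselJZero (q ^ 2 * t))
      rwa [sub_add_cancel] at this
    have h4 : q ^ 2 * m ≤ q ^ 2 * (√t * (|v t - besselJZero (q ^ 2 * t)|
        + |besselJZero (q ^ 2 * t)|)) := by
      rw [hm]
      gcongr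
    nlinarith [mul_le_mul_of_nonneg_left h2 hq.le]
  have h1 := henergy 1 (right_mem_Icc.2 zero_le_one)
  have hv_one : v 1 = Real.exp (-1 / 2) * laguerreL n 1 := by simp [hv]
  rw [Real.sqrt_one, one_mul, mul_one, hv_one] at h1
  -- `hqm` says `(1 - 5 / (3 q²)) q m ≤ 1.1`, and `q² ≥ 3.46`.
  have h2 : q * m ≤ 2.124 := by
    have h3 : q ^ 2 * (q * m) ≤ 1.1 * q ^ 2 + 5 / 3 * (q * m) := by
      nlinarith [mul_le_mul_of_nonneg_left hqm hq.le]
    by_contra! h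
    nlinarith
  calc q ^ 3 * |Real.exp (-1 / 2) * laguerreL n 1 - besselJZero (q ^ 2)|
      = q * (q ^ 2 * |Real.exp (-1 / 2) * laguerreL n 1 - besselJZero (q ^ 2)|) := by ring
    _ ≤ q * (5 / 3 * m) := by gcongr
    _ ≤ 3.54 := by linarith

lemma sqrt_exp_one_le : √(Real.exp 1) ≤ 1.6488 :=
  Real.sqrt_le_iff.2 ⟨by norm_num, by nlinarith [Real.exp_one_lt_d9]⟩

lemma sqrt_exp_one_div_pi_le : √(Real.exp 1 / Real.pi) ≤ 0.932 := by
  rw [Real.sqrt_div' _ Real.pi_pos.le, div_eq_mul_inv]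
  calc √(Real.exp 1) * (√Real.pi)⁻¹ ≤ 1.6488 * 0.565 := by
        gcongr
        exacts [sqrt_exp_one_le, inv_sqrt_pi_le]
    _ ≤ 0.932 := by norm_num

/-- The asymptotic formula in terms of `r = n^(1/4)`, for `n ≥ 3`. -/
lemma abs_laguerreL_one_sub_lt_of_three_le {n : ℕ} (hn : 3 ≤ n) {r : ℝ} (hr : 0 < r)
    (hrn : r ^ 2 = √(n : ℝ)) :
    |laguerreL n 1 - √(Real.exp 1 / Real.pi) * (Real.cos (2 * √(n : ℝ) - Real.pi / 4) / r)|
      < 2.38 / r ^ 3 := by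
  have hpi : 0 < √Real.pi := Real.sqrt_pos.2 Real.pi_pos
  have h2 : √(2 : ℝ) ^ 2 = 2 := Real.sq_sqrt (by norm_num)
  have h2pos : 0 < √(2 : ℝ) := by positivity
  set q := √2 * r with hq
  have hq0 : 0 < q := by positivity
  have hq2 : q ^ 2 = 2 * √(n : ℝ) := by rw [hq, mul_pow, h2, hrn]
  have hn' : (3 : ℝ) ≤ n := by exact_mod_cast hn
  -- `2√3 = 3.464…`
  have hq2le : 3.46 ≤ q ^ 2 := by
    rw [hq2]
    have : (1.73 : ℝ) ≤ √(n : ℝ) := Real.le_sqrt_of_sq_le (by norm_num; linarith)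
    linarith
  have hLag := pow_three_mul_abs_laguerreL_sub_besselJZero_le (n := n) hq0
    (by rw [hq2, mul_pow, Real.sq_sqrt (by positivity)]; ring) hq2le
  have hBes := abs_sqrt_mul_besselJZero_sub_le (x := q ^ 2) (by positivity)
  rw [Real.sqrt_sq hq0.le] at hBes
  have hcs : Real.cos (q ^ 2) + Real.sin (q ^ 2)
      = √2 * Real.cos (2 * √(n : ℝ) - Real.pi / 4) := by
    rw [← hq2, Real.cos_sub, Real.cos_pi_div_four, Real.sin_pi_div_four]
    linear_combination -(Real.cos (q ^ 2) + Real.sin (q ^ 2)) / 2 * h2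
  set C := Real.cos (2 * √(n : ℝ) - Real.pi / 4) with hC
  set L := laguerreL n 1
  have hexp : √(Real.exp 1) * Real.exp (-1 / 2) = 1 := by
    rw [← Real.exp_half, ← Real.exp_add]
    norm_num
  have hdecomp : L - √(Real.exp 1 / Real.pi) * (C / r)
      = √(Real.exp 1) * ((Real.exp (-1 / 2) * L - besselJZero (q ^ 2))
        + (q * besselJZero (q ^ 2) - √2 * C / √Real.pi) / q) := by
    rw [Real.sqrt_div' _ Real.pi_pos.le]
    have h3 : (q * besselJZero (q ^ 2) - √2 * C / √Real.pi) / q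
        = besselJZero (q ^ 2) - C / (√Real.pi * r) := by
      rw [hq]
      field_simp
    rw [h3]
    have h4 : √(Real.exp 1) / √Real.pi * (C / r) = √(Real.exp 1) * (C / (√Real.pi * r)) := by
      field_simp
    rw [h4]
    linear_combination -L * hexp
  have hr3 : r ^ 3 = q ^ 3 / (2 * √2) := by
    rw [hq, mul_pow, show √(2 : ℝ) ^ 3 = √2 ^ 2 * √2 by ring, h2]
    field_simp
  have hsum : q ^ 3 * |(Real.exp (-1 / 2) * L - besselJZero (q ^ 2))
        + (q * besselJZero (q ^ 2) - √2 * C / √Real.pi) / q| ≤ 3.8225 := by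
    rw [hcs] at hBes
    calc _ ≤ q ^ 3 * (|Real.exp (-1 / 2) * L - besselJZero (q ^ 2)|
          + |(q * besselJZero (q ^ 2) - √2 * C / √Real.pi) / q|) := by
          gcongr
          exact abs_add_le _ _
      _ = q ^ 3 * |Real.exp (-1 / 2) * L - besselJZero (q ^ 2)|
          + q ^ 2 * |q * besselJZero (q ^ 2) - √2 * C / √Real.pi| := by
          rw [abs_div, abs_of_pos hq0]
          field_simp
      _ ≤ 3.54 + q ^ 2 * (1 / (2 * √Real.pi * q ^ 2)) := by gcongr
      _ = 3.54 + (√Real.pi)⁻¹ / 2 := by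
          field_simp
      _ ≤ 3.8225 := by linarith [inv_sqrt_pi_le]
  rw [lt_div_iff₀ (by positivity), hdecomp, abs_mul, abs_of_nonneg (Real.sqrt_nonneg _), hr3]
  have h2le : (1.414 : ℝ) ≤ √2 := Real.le_sqrt_of_sq_le (by norm_num)
  set X := |(Real.exp (-1 / 2) * L - besselJZero (q ^ 2))
        + (q * besselJZero (q ^ 2) - √2 * C / √Real.pi) / q| with hX
  calc √(Real.exp 1) * X * (q ^ 3 / (2 * √2)) = √(Real.exp 1) * (q ^ 3 * X) / (2 * √2) := by ring
    _ ≤ 1.6488 * 3.8225 / (2 * 1.414) := by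
      gcongr
      exact sqrt_exp_one_le
    _ < 2.38 := by norm_num

theorem theorem1 (n : ℕ) (hn : 1 ≤ n) :
    |laguerreL n 1 -
        Real.sqrt (Real.exp 1 / Real.pi) *
          (Real.cos (2 * Real.sqrt (n : ℝ) - Real.pi / 4) / (n : ℝ) ^ (1 / 4 : ℝ))|
      < 2.38 / (n : ℝ) ^ (3 / 4 : ℝ) := by
  have hn0 : (0 : ℝ) < n := by exact_mod_cast hn
  set r : ℝ := (n : ℝ) ^ (1 / 4 : ℝ) with hr
  have hr0 : 0 < r := Real.rpow_pos_of_pos hn0 _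
  have hr2 : r ^ 2 = √(n : ℝ) := by
    rw [hr, ← Real.rpow_natCast, ← Real.rpow_mul hn0.le, Real.sqrt_eq_rpow]
    norm_num
  have hr3 : (n : ℝ) ^ (3 / 4 : ℝ) = r ^ 3 := by
    rw [hr, ← Real.rpow_natCast, ← Real.rpow_mul hn0.le]
    norm_num
  rw [hr3]
  rcases le_or_gt 3 n with h3 | h3
  · exact abs_laguerreL_one_sub_lt_of_three_le h3 hr0 hr2
  have hr4 : r ^ 4 = n := by
    rw [show r ^ 4 = (r ^ 2) ^ 2 by ring, hr2, Real.sq_sqrt hn0.le]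
  have hmain : |√(Real.exp 1 / Real.pi) * (Real.cos (2 * √(n : ℝ) - Real.pi / 4) / r)|
      ≤ 0.932 / r := by
    rw [abs_mul, abs_div, abs_of_pos hr0, abs_of_nonneg (Real.sqrt_nonneg _)]
    calc _ ≤ 0.932 * (1 / r) := by
          gcongr
          exacts [sqrt_exp_one_div_pi_le, Real.abs_cos_le_one _]
      _ = 0.932 / r := by ring
  -- For `n = 1, 2` the trivial bound on the cosine suffices.
  refine lt_of_le_of_lt ((abs_sub _ _).trans (add_le_add_right hmain _)) ?_
  rw [lt_div_iff₀ (by positivity)]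
  have hsplit : ∀ y : ℝ, (y + 0.932 / r) * r ^ 3 = y * r ^ 3 + 0.932 * r ^ 2 := fun y => by
    field_simp
  rw [hsplit]
  obtain rfl | rfl : n = 1 ∨ n = 2 := by omega
  · have : r = 1 := by rw [hr]; simp
    rw [laguerreL_one_one, this]
    norm_num
  · have hr_lt : r < 1.19 := by
      by_contra! h
      have : (1.19 : ℝ) ^ 4 ≤ r ^ 4 := by gcongr
      rw [hr4] at this
      norm_num at this
    rw [laguerreL_two_one]
    have h5 : r ^ 2 ≤ 1.19 ^ 2 := by gcongr
    have h6 : r ^ 3 ≤ 1.19 ^ 3 := by gcongr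
    norm_num at h5 h6 ⊢
    linarith
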